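/- Let $X$ be a real Banach space and let $P\subseteq X$ be a closed convex cone, i.e. $P$ is closed and nonempty, $P\neq\{0\}$, $\alpha x+\beta y\in P$ for all $x,y\in P$ and all real $\alpha,\beta\ge 0$, and $P\cap(-P)=\{0\}$; assume also that $P$ has nonempty interior. Order $X$ by $x\preceq y$ if and only if $y-x\in P$, and assume that $X$ has the upper comparable property: for all $x,y\in X$ there is $z\in X$ with $x\preceq z$ and $y\preceq z$. Let $S\subseteq X$ be nonempty, closed, convex and bounded, and let $A:X\to X$ and $B:S\to X$ be maps such that: (a) there exist a function $\psi:[0,\infty)\to[0,\infty)$ that is lower semicontinuous and non-decreasing with $\psi(t)=0$ if and only if $t=0$, an upper semicontinuous function $\theta:[0,\infty)\to[0,\infty)$ and a lower semicontinuous function $\varphi:[0,\infty)\to[0,\infty)$ with $\theta(0)=\varphi(0)=0$ and $\psi(t)-\theta(t)+\varphi(t)>0$ for all $t>0$, such that $$\psi(\|Ax-Ay\|)\le\theta(\|x-y\|)-\varphi(\|x-y\|)\qquad\text{whenever } y\preceq x;$$ (b) there exists $x_0\in X$ with $x_0\preceq Ax_0$; (c) $A$ is continuous and non-decreasing (that is,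 $x\preceq y$ implies $Ax\preceq Ay$), and $(I-A)^{-1}$ exists and is continuous, in the sense that $I-A$ is injective and its inverse, defined on the range $(I-A)(X)$, is continuous (this includes the case where $I-A$ is a bijection of $X$ with continuous inverse); (d) $B$ is continuous and $B(S)$ is contained in a compact subset of $P$; (e) for all $y\in S$ and $x\in X$, if $x=Ax+By$ then $x\in S$. Then $A+B$ has a fixed point in $S$: there exists $x\in S$ with $Ax+Bx=x$. -/

import Mathlib

open scoped NNReal Pointwise

/-- The cones used to order a real Banach space. Being a `ProperCone`, `P` is closed, nonempty, and
stable under linear combinations with nonnegative coefficients; moreover `P ≠ {0}`,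
`P ∩ (-P) = {0}`, and `P` has an interior point. -/
structure IsOrderCone {X : Type*} [NormedAddCommGroup X] [NormedSpace ℝ X]
    (P : ProperCone ℝ X) : Prop where
  ne_zero : (P : Set X) ≠ {0}
  inter_neg : (P : Set X) ∩ -(P : Set X) = {0}
  interior_nonempty : (interior (P : Set X)).Nonempty

/-- The order `x ⪯ y` induced by the cone `P`: `y - x ∈ P`. -/
def ConeLE {X : Type*} [NormedAddCommGroup X] [NormedSpace ℝ X]
    (P : ProperCone ℝ X) (x y : X) : Prop :=
  y - x ∈ P

/-- Any two elements have a common upper bound in the order induced by `P`. -/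
def UpperComparable {X : Type*} [NormedAddCommGroup X] [NormedSpace ℝ X]
    (P : ProperCone ℝ X) : Prop :=
  ∀ x y : X, ∃ z : X, ConeLE P x z ∧ ConeLE P y z

/-- Generalized altering distance functions `[0, ∞) → [0, ∞)`. -/
structure IsGeneralizedAlteringDistance (ψ : ℝ≥0 → ℝ≥0) : Prop where
  lowerSemicontinuous : LowerSemicontinuous ψ
  monotone : Monotone ψ
  eq_zero_iff : ∀ t : ℝ≥0, ψ t = 0 ↔ t = 0

/-- `A` is a `(ψ, θ, φ)`-weak contraction on comparable pairs. The differences are taken in `ℝ`. -/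
structure IsWeakContraction {X : Type*} [NormedAddCommGroup X] [NormedSpace ℝ X]
    (P : ProperCone ℝ X) (ψ θ φ : ℝ≥0 → ℝ≥0) (A : X → X) : Prop where
  altering : IsGeneralizedAlteringDistance ψ
  upperSemicontinuous : UpperSemicontinuous θ
  lowerSemicontinuous : LowerSemicontinuous φ
  theta_zero : θ 0 = 0
  phi_zero : φ 0 = 0
  pos : ∀ t : ℝ≥0, 0 < t → 0 < (ψ t : ℝ) - (θ t : ℝ) + (φ t : ℝ)
  le : ∀ x y : X, ConeLE P y x →
    (ψ ‖A x - A y‖₊ : ℝ) ≤ (θ ‖x - y‖₊ : ℝ) - (φ ‖x - y‖₊ : ℝ)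

/-- The map `T` is injective, and its inverse, defined on the range of `T` with the subspace
topology, is continuous. When `T` is onto, this is a continuous inverse on the whole space. -/
def HasContinuousInverse {X : Type*} [TopologicalSpace X] (T : X → X) : Prop :=
  ∃ hT : Function.Injective T, Continuous (Equiv.ofInjective T hT).symm

/-!
A solution of `A x + B x = x` is a fixed point of `T = (I - A)⁻¹ ∘ B`, and `T` is well behaved
because the range of `I - A` contains the whole cone `P`. Indeed, for `k ∈ P` the iteration
`x ↦ A x + k`, started at a point `x₀ ⪯ A x₀`, is increasing, so the contraction condition applies to
any two of its terms. By semicontinuity the inequality `ψ > θ - φ` at `ε` persists nearby, which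
gives a Meir-Keeler condition (`IsWeakContraction.exists_gap`): comparable points whose distance is
within `δ` of `ε` have images at distance at most `ε - δ`. This makes the iteration Cauchy, and its
limit solves `x = A x + k` (`IsWeakContraction.exists_eq_add`).

Hence, if `K ⊆ P` is a compact set containing the range of `B`, the continuous map `(I - A)⁻¹` is
defined on `K`, and `T` is a continuous self-map of the convex set `S` with image in the compact set
`S ∩ (I - A)⁻¹(K)`. Schauder's theorem (`exists_isFixedPt_of_mapsTo_compact`) concludes.

Schauder's theorem is reduced to Brouwer's theorem on a simplex by projecting onto the hull of
finite nets. Brouwer's theorem follows, by smoothing, from the absence of `C¹` retractions `r` of the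
unit ball onto its boundary (`not_contDiffAt_retraction`), which is proved by Milnor's and Rogers'
volume argument: `∫ det (I + t (Dr - I))` over the ball is polynomial in `t`. For small `t ≥ 0` it is
the volume of the ball, because `x ↦ x + t (r x - x)` is then a bijection of the ball, and at `t = 1`
it vanishes, because `Dr` is singular.
-/

/-! ### Monotone weak contractions -/

section WeakContraction

open Filter Topology

variable {X : Type*} [NormedAddCommGroup X] [NormedSpace ℝ X] {P : ProperCone ℝ X}

theorem coneLE_trans {x y z : X} (hxy : ConeLE P x y) (hyz : ConeLE P y z) : ConeLE P x z := by
  have h := P.add_mem hyz hxy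
  rwa [sub_add_sub_cancel] at h

theorem coneLE_of_le {u : ℕ → X} (hu : ∀ n, ConeLE P (u n) (u (n + 1))) {m n : ℕ} (hmn : m ≤ n) :
    ConeLE P (u m) (u n) := by
  induction n, hmn using Nat.le_induction with
  | base => simp [ConeLE]
  | succ n _ ih => exact coneLE_trans ih (hu n)

/-- A weak contraction strictly decreases the distance of distinct comparable points. -/
theorem IsWeakContraction.nnnorm_lt {ψ θ φ : ℝ≥0 → ℝ≥0} {A : X → X}
    (h : IsWeakContraction P ψ θ φ A) {x y : X} (hyx : ConeLE P y x) (hne : 0 < ‖x - y‖₊) :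
    ‖A x - A y‖₊ < ‖x - y‖₊ := by
  by_contra! hle
  have h1 : (ψ ‖x - y‖₊ : ℝ) ≤ ψ ‖A x - A y‖₊ := by exact_mod_cast h.altering.monotone hle
  linarith [h.le x y hyx, h.pos _ hne]

theorem IsWeakContraction.nnnorm_le {ψ θ φ : ℝ≥0 → ℝ≥0} {A : X → X}
    (h : IsWeakContraction P ψ θ φ A) {x y : X} (hyx : ConeLE P y x) :
    ‖A x - A y‖₊ ≤ ‖x - y‖₊ := by
  rcases eq_or_ne ‖x - y‖₊ 0 with h0 | h0
  · have : x = y := sub_eq_zero.1 (nnnorm_eq_zero.1 h0)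
    simp [this]
  · exact (h.nnnorm_lt hyx (pos_iff_ne_zero.2 h0)).le

/-- A weak contraction satisfies a Meir-Keeler type condition with a gap on both sides: comparable
points at distance close to `ε` are brought to a distance at most `ε - δ`. -/
theorem IsWeakContraction.exists_gap {ψ θ φ : ℝ≥0 → ℝ≥0} {A : X → X}
    (h : IsWeakContraction P ψ θ φ A) {ε : ℝ} (hε : 0 < ε) :
    ∃ δ : ℝ, 0 < δ ∧ ∀ x y : X, ConeLE P y x → ε - δ < ‖x - y‖ → ‖x - y‖ < ε + δ →
      ‖A x - A y‖ ≤ ε - δ := by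
  lift ε to ℝ≥0 using hε.le
  have hε' : 0 < ε := by exact_mod_cast hε
  have hpos := h.pos ε hε'
  set η : ℝ := ((ψ ε : ℝ) - θ ε + φ ε) / 3 with hη
  have hη0 : 0 < η := by positivity
  -- near `ε` the three functions move in the unfavourable direction by less than `η` each
  have hψ : ∀ᶠ s in 𝓝 ε, (ψ ε : ℝ) - η < ψ s :=
    (NNReal.continuous_coe.comp_lowerSemicontinuous h.altering.lowerSemicontinuous
      (fun a b hab => by exact_mod_cast hab)) ε _ (by simpa using hη0)
  have hφ : ∀ᶠ s in 𝓝 ε, (φ ε : ℝ) - η < φ s :=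
    (NNReal.continuous_coe.comp_lowerSemicontinuous h.lowerSemicontinuous
      (fun a b hab => by exact_mod_cast hab)) ε _ (by simpa using hη0)
  have hθ : ∀ᶠ s in 𝓝 ε, (θ s : ℝ) < θ ε + η :=
    (NNReal.continuous_coe.comp_upperSemicontinuous h.upperSemicontinuous
      (fun a b hab => by exact_mod_cast hab)) ε _ (by simpa using hη0)
  obtain ⟨δ, hδ, H⟩ := Metric.eventually_nhds_iff.1 (hψ.and (hφ.and hθ))
  refine ⟨min δ ε, by positivity, fun x y hyx h1 h2 => ?_⟩
  have hm1 := min_le_left δ (ε : ℝ)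
  have hm2 := min_le_right δ (ε : ℝ)
  have hlt : ‖A x - A y‖ < ‖x - y‖ := h.nnnorm_lt hyx (by
    rw [← NNReal.coe_pos, coe_nnnorm]; linarith)
  by_contra! hcon
  have hA := (H (y := ‖A x - A y‖₊) (by
    rw [NNReal.dist_eq, coe_nnnorm, abs_lt]; constructor <;> linarith)).1
  have hx := (H (y := ‖x - y‖₊) (by
    rw [NNReal.dist_eq, coe_nnnorm, abs_lt]; constructor <;> linarith)).2
  linarith [h.le x y hyx, hx.1, hx.2]

/-- A monotone iteration whose steps satisfy the gap condition of a weak contraction is Cauchy. -/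
theorem IsWeakContraction.cauchySeq {ψ θ φ : ℝ≥0 → ℝ≥0} {A : X → X}
    (h : IsWeakContraction P ψ θ φ A) {k : X} {u : ℕ → X}
    (hmono : ∀ n, ConeLE P (u n) (u (n + 1))) (hu : ∀ n, u (n + 1) = A (u n) + k) :
    CauchySeq u := by
  have hsub : ∀ m n, u (m + 1) - u (n + 1) = A (u m) - A (u n) := fun m n => by
    rw [hu, hu, add_sub_add_right_eq_sub]
  have hanti : Antitone fun n => ‖u (n + 1) - u n‖ := antitone_nat_of_succ_le fun n => by
    rw [hsub]; exact h.nnnorm_le (hmono n)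
  have hbdd : BddBelow (Set.range fun n => ‖u (n + 1) - u n‖) :=
    ⟨0, by rintro _ ⟨n, rfl⟩; exact norm_nonneg _⟩
  have hlim := tendsto_atTop_ciInf hanti hbdd
  set d := ⨅ n, ‖u (n + 1) - u n‖ with hd
  have hd_le : ∀ n, d ≤ ‖u (n + 1) - u n‖ := fun n => ciInf_le hbdd n
  have hd0 : d = 0 := by
    by_contra hne
    have hdpos : 0 < d := lt_of_le_of_ne (le_ciInf fun n => norm_nonneg _) (Ne.symm hne)
    obtain ⟨δ, hδ, H⟩ := h.exists_gap hdpos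
    obtain ⟨n, hn⟩ := (hlim.eventually_lt_const (show d < d + δ by linarith)).exists
    have := H _ _ (hmono n) (by linarith [hd_le n]) hn
    rw [← hsub] at this
    linarith [hd_le (n + 1)]
  rw [hd0] at hlim
  refine Metric.cauchySeq_iff'.2 fun ε hε => ?_
  obtain ⟨δ, hδ, H⟩ := h.exists_gap hε
  obtain ⟨N, hN⟩ := (hlim.eventually_lt_const (lt_min hδ hε)).exists_forall_of_atTop
  refine ⟨N, fun n hn => ?_⟩
  rw [dist_eq_norm]
  -- the ball of radius `ε` around `u N` is invariant under the iteration from the index `N` on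
  induction n, hn using Nat.le_induction with
  | base => simpa using hε
  | succ n hn ih =>
    rcases lt_or_ge (ε - δ) ‖u n - u N‖ with hgap | hgap
    · have h1 := H _ _ (coneLE_of_le hmono hn) hgap (by linarith)
      rw [← hsub] at h1
      have h2 := (hN N le_rfl).trans_le (min_le_left _ _)
      have h3 := norm_sub_le_norm_sub_add_norm_sub (u (n + 1)) (u (N + 1)) (u N)
      linarith
    · have h2 := (hN n hn).trans_le (min_le_left _ _)
      have h3 := norm_sub_le_norm_sub_add_norm_sub (u (n + 1)) (u n) (u N)
      linarith

/-- The equation `x = A x + k` is solvable for every `k` in the cone, by iterating `x ↦ A x + k`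
from a point below its image. -/
theorem IsWeakContraction.exists_eq_add [CompleteSpace X] {ψ θ φ : ℝ≥0 → ℝ≥0} {A : X → X}
    (h : IsWeakContraction P ψ θ φ A) (hcont : Continuous A)
    (hmono : ∀ x y : X, ConeLE P x y → ConeLE P (A x) (A y))
    (hstart : ∃ x₀ : X, ConeLE P x₀ (A x₀)) {k : X} (hk : k ∈ P) : ∃ x, x = A x + k := by
  obtain ⟨x₀, hx₀⟩ := hstart
  let u : ℕ → X := fun n => (fun x => A x + k)^[n] x₀
  have hu : ∀ n, u (n + 1) = A (u n) + k := fun n => Function.iterate_succ_apply' _ _ _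
  have hle : ∀ n, ConeLE P (u n) (u (n + 1)) := by
    intro n
    induction n with
    | zero =>
      have := P.add_mem hx₀ hk
      rw [hu]
      change A x₀ + k - x₀ ∈ P
      rwa [sub_add_eq_add_sub] at this
    | succ n ih =>
      have := hmono _ _ ih
      rw [hu (n + 1), ConeLE]
      nth_rewrite 2 [hu n]
      rwa [add_sub_add_right_eq_sub]
  obtain ⟨x, hx⟩ := cauchySeq_tendsto_of_complete (h.cauchySeq hle hu)
  refine ⟨x, tendsto_nhds_unique ((tendsto_add_atTop_iff_nat 1).2 hx) ?_⟩
  simp_rw [hu]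
  exact ((hcont.tendsto x).comp hx).add_const k

end WeakContraction

/-! ### Brouwer's fixed point theorem -/

section Brouwer

open MeasureTheory Metric Set Module Polynomial

theorem bijective_add_smul {E : Type*} [NormedAddCommGroup E] [NormedSpace ℝ E] [CompleteSpace E]
    {G : E → E} {K t : ℝ} (hG : ∀ x y, ‖G x - G y‖ ≤ K * ‖x - y‖) (ht : 0 ≤ t) (htK : t * K < 1) :
    Function.Bijective fun x => x + t • G x := by
  have hlip : ∀ x y, ‖t • G x - t • G y‖ ≤ t * K * ‖x - y‖ := fun x y => by
    rw [← smul_sub, norm_smul, Real.norm_of_nonneg ht, mul_assoc]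
    exact mul_le_mul_of_nonneg_left (hG x y) ht
  constructor
  · intro x y hxy
    have h1 : x - y = -(t • G x - t • G y) := by
      have : x + t • G x = y + t • G y := hxy
      rw [neg_sub, sub_eq_sub_iff_add_eq_add, this, add_comm]
    have h2 := hlip x y
    rw [← norm_neg (t • G x - t • G y), ← h1] at h2
    have h3 : ‖x - y‖ = 0 := by nlinarith [norm_nonneg (x - y)]
    exact sub_eq_zero.1 (norm_eq_zero.1 h3)
  · intro y
    have hc : ContractingWith (t * K).toNNReal fun x => y - t • G x := by
      refine ⟨by simpa using htK, LipschitzWith.of_dist_le_mul fun a b => ?_⟩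
      rw [dist_eq_norm, dist_eq_norm, sub_sub_sub_cancel_left, norm_sub_rev]
      exact (hlip a b).trans (mul_le_mul_of_nonneg_right (Real.le_coe_toNNReal _) (norm_nonneg _))
    have := hc.fixedPoint_isFixedPt
    refine ⟨_, eq_sub_iff_add_eq.1 this.symm⟩

/-- A map that is Lipschitz on the closed unit ball and vanishes on the unit sphere remains
Lipschitz, with the same constant, when it is extended by zero. -/
theorem norm_indicator_sub_le {E F : Type*} [NormedAddCommGroup E] [NormedSpace ℝ E]
    [NormedAddCommGroup F] {g : E → F} {K : ℝ} (hK : 0 ≤ K)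
    (hg : ∀ x ∈ closedBall (0 : E) 1, ∀ y ∈ closedBall (0 : E) 1, ‖g x - g y‖ ≤ K * ‖x - y‖)
    (h0 : ∀ x, ‖x‖ = 1 → g x = 0) (x y : E) :
    ‖(closedBall 0 1).indicator g x - (closedBall 0 1).indicator g y‖ ≤ K * ‖x - y‖ := by
  have key : ∀ x y : E, x ∈ closedBall (0 : E) 1 → y ∉ closedBall (0 : E) 1 →
      ‖g x‖ ≤ K * ‖x - y‖ := by
    intro x y hx hy
    rw [mem_closedBall_zero_iff] at hx hy
    have hcont : ContinuousOn (fun s : ℝ => ‖AffineMap.lineMap x y s‖) (Icc 0 1) :=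
      (AffineMap.lineMap_continuous.norm).continuousOn
    -- the segment from `x` to `y` meets the unit sphere, where `g` vanishes
    obtain ⟨s, hs, hs1⟩ := intermediate_value_Icc zero_le_one hcont
      (show (1 : ℝ) ∈ _ by simpa using ⟨hx, (not_le.1 hy).le⟩)
    set z := AffineMap.lineMap x y s with hz
    have h1 := hg x (by simpa using hx) z (by rw [mem_closedBall_zero_iff]; exact hs1.le)
    rw [h0 z hs1, sub_zero] at h1
    refine h1.trans (mul_le_mul_of_nonneg_left ?_ hK)
    rw [← dist_eq_norm, hz, dist_left_lineMap, Real.norm_of_nonneg hs.1, dist_eq_norm]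
    exact mul_le_of_le_one_left (norm_nonneg _) hs.2
  by_cases hx : x ∈ closedBall (0 : E) 1 <;> by_cases hy : y ∈ closedBall (0 : E) 1
  · simpa only [indicator_of_mem hx, indicator_of_mem hy] using hg x hx y hy
  · simpa only [indicator_of_mem hx, indicator_of_notMem hy, sub_zero] using key x y hx hy
  · rw [indicator_of_notMem hx, indicator_of_mem hy, zero_sub, norm_neg, norm_sub_rev x]
    exact key y x hy hx
  · simp only [indicator_of_notMem hx, indicator_of_notMem hy, sub_zero, norm_zero]
    positivity

theorem exists_polynomial_eval_eq_det {E : Type*} [NormedAddCommGroup E] [NormedSpace ℝ E]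
    [FiniteDimensional ℝ E] (M : E →L[ℝ] E) :
    ∃ q : ℝ[X], q.natDegree ≤ finrank ℝ E ∧
      ∀ t : ℝ, q.eval t = (ContinuousLinearMap.id ℝ E + t • M).det := by
  let b := finBasis ℝ E
  let N := LinearMap.toMatrix b b M
  refine ⟨_, (natDegree_det_X_add_C_le N 1).trans_eq (Fintype.card_fin _), fun t => ?_⟩
  have h1 : LinearMap.toMatrix b b (ContinuousLinearMap.id ℝ E + t • M : E →L[ℝ] E) =
      t • N + 1 := by
    simp [N, add_comm, ContinuousLinearMap.coe_id]
  rw [ContinuousLinearMap.det, ← LinearMap.det_toMatrix b, h1, ← coe_evalRingHom,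
    RingHom.map_det]
  congr 1
  ext i j
  by_cases hij : i = j <;> simp [hij, N] <;> ring

theorem det_id_add_smul_pos {E : Type*} [NormedAddCommGroup E] [NormedSpace ℝ E]
    [FiniteDimensional ℝ E] {M : E →L[ℝ] E} {K t : ℝ} (hM : ‖M‖ ≤ K) (ht : 0 ≤ t)
    (htK : t * K < 1) : 0 < (ContinuousLinearMap.id ℝ E + t • M).det := by
  have hcont : Continuous fun s : ℝ => (ContinuousLinearMap.id ℝ E + s • M).det :=
    ContinuousLinearMap.continuous_det.comp (by fun_prop)
  have hK : 0 ≤ K := (norm_nonneg _).trans hM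
  by_contra! hneg
  -- the determinant is `1` at `s = 0`, so it would vanish for some `s ∈ [0, t]`
  obtain ⟨s, hs, hs0⟩ := intermediate_value_Icc' ht hcont.continuousOn
    (show (0 : ℝ) ∈ _ from ⟨hneg, by simp [ContinuousLinearMap.det]⟩)
  obtain ⟨v, hv, hv0⟩ := (Submodule.ne_bot_iff _).1 (LinearMap.bot_lt_ker_of_det_eq_zero hs0).ne'
  have hv' : v + s • M v = 0 := by simpa using hv
  have h1 : ‖v‖ ≤ s * K * ‖v‖ := by
    conv_lhs => rw [eq_neg_of_add_eq_zero_left hv', norm_neg, norm_smul, Real.norm_of_nonneg hs.1]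
    rw [mul_assoc]
    exact mul_le_mul_of_nonneg_left (M.le_of_opNorm_le hM v) hs.1
  have h2 : s * K ≤ t * K := mul_le_mul_of_nonneg_right hs.2 hK
  nlinarith [norm_pos_iff.2 hv0]

/-- There is no `C¹` retraction of the closed unit ball onto the unit sphere. -/
theorem not_contDiffAt_retraction {E : Type*} [NormedAddCommGroup E] [InnerProductSpace ℝ E]
    [FiniteDimensional ℝ E] {r : E → E} (hr : ∀ x ∈ closedBall (0 : E) 1, ContDiffAt ℝ 1 r x)
    (hr1 : ∀ x ∈ closedBall (0 : E) 1, ‖r x‖ = 1) (hrid : ∀ x, ‖x‖ = 1 → r x = x) : False := by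
  borelize E
  let μ : Measure E := Measure.addHaar
  let M : E → E →L[ℝ] E := fun x => fderiv ℝ r x - ContinuousLinearMap.id ℝ E
  have hMcont : ContinuousOn M (closedBall 0 1) := fun x hx =>
    (((hr x hx).fderiv_right (m := 0) (by simp)).continuousAt.sub
      continuousAt_const).continuousWithinAt
  have hder : ∀ x ∈ closedBall (0 : E) 1, HasFDerivAt (fun y => r y - y) (M x) x := fun x hx =>
    ((hr x hx).differentiableAt (by simp)).hasFDerivAt.sub (hasFDerivAt_id x)
  obtain ⟨K, hK⟩ := (isCompact_closedBall (0 : E) 1).exists_bound_of_continuousOn hMcont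
  have hK0 : 0 ≤ K := (norm_nonneg _).trans (hK 0 (by simp))
  have hlip : ∀ x ∈ closedBall (0 : E) 1, ∀ y ∈ closedBall (0 : E) 1,
      ‖(r x - x) - (r y - y)‖ ≤ K * ‖x - y‖ := fun x hx y hy =>
    (convex_closedBall (0 : E) 1).norm_image_sub_le_of_norm_hasFDerivWithin_le
      (fun z hz => (hder z hz).hasFDerivWithinAt) hK hy hx
  let J : ℝ → E → ℝ := fun t x => (ContinuousLinearMap.id ℝ E + t • M x).det
  have hJint : ∀ t, IntegrableOn (J t) (ball 0 1) μ := fun t =>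
    ((ContinuousLinearMap.continuous_det.comp_continuousOn
      (continuousOn_const.add (hMcont.const_smul t))).integrableOn_compact
        (isCompact_closedBall 0 1)).mono_set ball_subset_closedBall
  -- for small `t` the map `x ↦ x + t (r x - x)` is a bijection of the unit ball
  have hsmall : ∀ t, 0 ≤ t → t * K < 1 → ∫ x in ball 0 1, J t x ∂μ = μ.real (ball 0 1) := by
    intro t ht htK
    set G : E → E := (closedBall (0 : E) 1).indicator fun x => r x - x with hG
    have hbij := bijective_add_smul
      (norm_indicator_sub_le hK0 hlip fun x hx => sub_eq_zero.2 (hrid x hx)) ht htK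
    rw [← hG] at hbij
    have hGout : ∀ x, 1 ≤ ‖x‖ → x + t • G x = x := by
      intro x hx
      rcases hx.lt_or_eq with hx | hx
      · rw [hG, indicator_of_notMem (by simpa using hx), smul_zero, add_zero]
      · rw [hG, indicator_of_mem (by simp [hx.symm]), hrid x hx.symm, sub_self, smul_zero, add_zero]
    have himg : (fun x => x + t • G x) '' ball 0 1 = ball 0 1 := by
      ext y
      constructor
      · rintro ⟨x, hx, rfl⟩
        by_contra hy
        have hy' : 1 ≤ ‖x + t • G x‖ := by simpa using hy
        have : x + t • G x = x := hbij.1 (hGout _ hy')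
        rw [this] at hy'
        exact absurd (mem_ball_zero_iff.1 hx) hy'.not_gt
      · intro hy
        obtain ⟨x, rfl⟩ := hbij.2 y
        refine ⟨x, ?_, rfl⟩
        by_contra hx
        have hx' : 1 ≤ ‖x‖ := by simpa using hx
        have hy' := mem_ball_zero_iff.1 hy
        simp only [hGout x hx'] at hy'
        exact absurd hy' hx'.not_gt
    have heq : ∀ x ∈ ball (0 : E) 1, x + t • G x = x + t • (r x - x) := fun x hx => by
      rw [hG, indicator_of_mem (ball_subset_closedBall hx)]
    have hfd : ∀ x ∈ ball (0 : E) 1, HasFDerivWithinAt (fun x => x + t • G x)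
        (ContinuousLinearMap.id ℝ E + t • M x) (ball 0 1) x := fun x hx =>
      (((hasFDerivAt_id x).add
        ((hder x (ball_subset_closedBall hx)).const_smul t)).hasFDerivWithinAt).congr
          heq (heq x hx)
    have hcv := integral_image_eq_integral_abs_det_fderiv_smul μ measurableSet_ball hfd
      hbij.1.injOn fun _ => (1 : ℝ)
    rw [himg, setIntegral_const, smul_eq_mul, mul_one] at hcv
    rw [hcv]
    refine setIntegral_congr_fun measurableSet_ball fun x hx => ?_
    have hpos := det_id_add_smul_pos (hK x (ball_subset_closedBall hx)) ht htK
    simp only [J, smul_eq_mul, mul_one, abs_of_pos hpos]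
  -- at `t = 1` the integrand vanishes, since `r` takes values in the unit sphere
  have hone : ∫ x in ball 0 1, J 1 x ∂μ = 0 := by
    refine (setIntegral_congr_fun measurableSet_ball fun x hx => ?_).trans (integral_zero _ _)
    have hx' := ball_subset_closedBall hx
    have hrd := ((hr x hx').differentiableAt (by simp)).hasFDerivAt
    have hconst : (fun y => inner ℝ (r y) (r y)) =ᶠ[nhds x] fun _ => (1 : ℝ) := by
      filter_upwards [isOpen_ball.mem_nhds hx] with y hy
      rw [real_inner_self_eq_norm_sq, hr1 y (ball_subset_closedBall hy), one_pow]
    have hz := ((hrd.inner ℝ hrd).congr_of_eventuallyEq hconst.symm).unique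
      (hasFDerivAt_const (1 : ℝ) x)
    have horth : ∀ v, inner ℝ (r x) (fderiv ℝ r x v) = 0 := fun v => by
      have := DFunLike.congr_fun hz v
      simp [real_inner_comm] at this
      linarith
    have hJ1 : J 1 x = (fderiv ℝ r x).det := by simp [J, M]
    rw [hJ1]
    by_contra hdet
    have hunit : IsUnit (LinearMap.det (fderiv ℝ r x : E →ₗ[ℝ] E)) := isUnit_iff_ne_zero.2 hdet
    obtain ⟨v, hv⟩ := ((Module.End.isUnit_iff _).1 ((LinearMap.isUnit_iff_isUnit_det _).2 hunit)).2
      (r x)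
    have h1 := horth v
    have hv' : fderiv ℝ r x v = r x := hv
    rw [hv', real_inner_self_eq_norm_sq, hr1 x hx'] at h1
    norm_num at h1
  -- interpolate the polynomial `t ↦ J t x` at `finrank ℝ E + 1` nodes in the range of small `t`
  let s := Finset.range (finrank ℝ E + 1)
  let node : ℕ → ℝ := fun i => 1 / ((K + 1) * (i + 1))
  have hnode0 : ∀ i, 0 ≤ node i := fun i => by positivity
  have hnodeK : ∀ i, node i * K < 1 := fun i => by
    rw [div_mul_eq_mul_div, one_mul, div_lt_one (by positivity)]
    nlinarith [(Nat.cast_nonneg i : (0 : ℝ) ≤ i)]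
  have hinj : Set.InjOn node s := fun i _ j _ hij => by
    have hK1 : K + 1 ≠ 0 := by positivity
    simpa [node, hK1] using hij
  let L : ℕ → ℝ := fun i => (Lagrange.basis s node i).eval 1
  have hL : ∑ i ∈ s, L i = 1 := by
    rw [← eval_finsetSum, Lagrange.sum_basis hinj (by simp [s]), eval_one]
  have hJ : ∀ x, J 1 x = ∑ i ∈ s, J (node i) x * L i := by
    intro x
    obtain ⟨q, hq, hqe⟩ := exists_polynomial_eval_eq_det (M x)
    have hdeg : q.degree < s.card := by
      refine degree_le_natDegree.trans_lt ?_
      rw [Finset.card_range]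
      exact_mod_cast Nat.lt_succ_of_le hq
    have h1 := congrArg (eval 1)
      (Lagrange.eq_interpolate_of_eval_eq (fun i => J (node i) x) hinj hdeg fun i _ => hqe _)
    rw [hqe, Lagrange.interpolate_apply, eval_finsetSum] at h1
    simpa [L, J] using h1
  have hfin : μ.real (ball (0 : E) 1) = 0 := by
    rw [← hone]
    simp_rw [hJ]
    rw [integral_finsetSum _ fun i _ => (hJint (node i)).mul_const (L i)]
    simp_rw [integral_mul_const, hsmall _ (hnode0 _) (hnodeK _)]
    rw [← Finset.mul_sum, hL, mul_one]
  have hpos : 0 < μ.real (ball (0 : E) 1) :=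
    ENNReal.toReal_pos (measure_ball_pos μ 0 one_pos).ne' measure_ball_lt_top.ne
  exact hpos.ne' hfin

/-- **Brouwer's fixed point theorem** for `C¹` maps: without a fixed point, pushing `x` away from
`f x` to the unit sphere is a `C¹` retraction of the ball onto its boundary. -/
theorem exists_isFixedPt_of_contDiff {E : Type*} [NormedAddCommGroup E] [InnerProductSpace ℝ E]
    [FiniteDimensional ℝ E] {f : E → E} (hf : ContDiff ℝ 1 f)
    (hball : MapsTo f (closedBall 0 1) (closedBall 0 1)) :
    ∃ x ∈ closedBall (0 : E) 1, f x = x := by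
  by_contra! hne
  -- `r x` is the point where the ray from `f x` through `x` leaves the ball: it is `x + c u`, with
  -- `c` the larger root of `a c ^ 2 + 2 b c + ‖x‖ ^ 2 - 1`
  let u : E → E := fun x => x - f x
  let a : E → ℝ := fun x => ‖u x‖ ^ 2
  let b : E → ℝ := fun x => inner ℝ x (u x)
  let D : E → ℝ := fun x => b x ^ 2 + a x * (1 - ‖x‖ ^ 2)
  let c : E → ℝ := fun x => (-b x + √(D x)) / a x
  let r : E → E := fun x => x + c x • u x
  have hu : ContDiff ℝ 1 u := contDiff_id.sub hf
  have ha : ContDiff ℝ 1 a := hu.norm_sq ℝ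
  have hb : ContDiff ℝ 1 b := contDiff_id.inner ℝ hu
  have hD : ContDiff ℝ 1 D :=
    (hb.pow 2).add (ha.mul (contDiff_const.sub (contDiff_id.norm_sq ℝ)))
  have hapos : ∀ x ∈ closedBall (0 : E) 1, 0 < a x := fun x hx =>
    pow_pos (norm_pos_iff.2 (sub_ne_zero.2 (hne x hx).symm)) 2
  have hbpos : ∀ x, ‖x‖ = 1 → 0 < b x := fun x hx => by
    have hx' : x ∈ closedBall (0 : E) 1 := by simp [hx]
    have h1 : ‖f x‖ ≤ 1 := by simpa using hball hx'
    have h2 := norm_sub_sq_real x (u x)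
    have h3 : x - u x = f x := sub_sub_cancel _ _
    rw [h3, hx] at h2
    have h4 := hapos x hx'
    simp only [a, b] at h4 ⊢
    nlinarith [norm_nonneg (f x)]
  have hDpos : ∀ x ∈ closedBall (0 : E) 1, 0 < D x := fun x hx => by
    have hx1 : ‖x‖ ≤ 1 := by simpa using hx
    rcases hx1.lt_or_eq with h | h
    · have h1 : 0 < a x * (1 - ‖x‖ ^ 2) :=
        mul_pos (hapos x hx) (by nlinarith [norm_nonneg x])
      have h2 := sq_nonneg (b x)
      simp only [D]
      linarith
    · have h1 := pow_pos (hbpos x h) 2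
      simpa [D, h] using h1
  refine not_contDiffAt_retraction (r := r) (fun x hx => ?_) (fun x hx => ?_) fun x hx => ?_
  · have hc : ContDiffAt ℝ 1 c x :=
      (hb.contDiffAt.neg.add (hD.contDiffAt.sqrt (hDpos x hx).ne')).div ha.contDiffAt
        (hapos x hx).ne'
    exact contDiffAt_id.add (hc.smul hu.contDiffAt)
  · have h1 : ‖r x‖ ^ 2 = ‖x‖ ^ 2 + 2 * (c x * b x) + c x ^ 2 * a x := by
      simp only [r, a, b]
      rw [norm_add_sq_real, inner_smul_right, norm_smul, mul_pow, Real.norm_eq_abs, sq_abs]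
    have h2 : c x * a x = -b x + √(D x) := div_mul_cancel₀ _ (hapos x hx).ne'
    have h3 : √(D x) ^ 2 = b x ^ 2 + a x * (1 - ‖x‖ ^ 2) := Real.sq_sqrt (hDpos x hx).le
    have h4 : a x * (‖r x‖ ^ 2 - 1) = 0 := by
      rw [h1]
      linear_combination (c x * a x + b x + √(D x)) * h2 + h3
    have h5 : ‖r x‖ ^ 2 = 1 :=
      sub_eq_zero.1 ((mul_eq_zero.1 h4).resolve_left (hapos x hx).ne')
    exact (pow_eq_one_iff_of_nonneg (norm_nonneg _) two_ne_zero).1 h5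
  · have : c x = 0 := by simp [c, D, hx, Real.sqrt_sq (hbpos x hx).le]
    simp [r, this]

/-- **Brouwer's fixed point theorem**, for a continuous map of the whole space into the closed unit
ball. -/
theorem exists_isFixedPt_of_norm_le_one {E : Type*} [NormedAddCommGroup E] [InnerProductSpace ℝ E]
    [FiniteDimensional ℝ E] {F : E → E} (hF : Continuous F) (hF1 : ∀ x, ‖F x‖ ≤ 1) :
    ∃ x, F x = x := by
  obtain ⟨x₀, -, hmin⟩ := (isCompact_closedBall (0 : E) 1).exists_isMinOn
    ⟨0, by simp⟩ (continuous_id.sub hF).norm.continuousOn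
  refine ⟨x₀, ?_⟩
  by_contra hne
  have hpos : 0 < ‖x₀ - F x₀‖ := norm_pos_iff.2 (sub_ne_zero.2 (Ne.symm hne))
  set η := ‖x₀ - F x₀‖ / 2 with hη
  have hη0 : 0 < η := by positivity
  obtain ⟨g, hg, hgF, -⟩ := hF.exists_contDiff_approx 1 (ε := fun _ => η) continuous_const
    fun _ => hη0
  have hg1 : ∀ x, ‖g x‖ ≤ 1 + η := fun x => by
    have h1 := hgF x
    rw [dist_eq_norm] at h1
    have h2 := norm_le_norm_add_norm_sub' (g x) (F x)
    linarith [hF1 x]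
  -- shrink the smooth approximation so that it maps into the ball
  obtain ⟨x, hx, hfix⟩ := exists_isFixedPt_of_contDiff (f := fun x => (1 + η)⁻¹ • g x)
    (hg.const_smul _) fun x _ => by
      rw [mem_closedBall_zero_iff, norm_smul, Real.norm_of_nonneg (by positivity),
        inv_mul_le_iff₀ (by positivity), mul_one]
      exact hg1 x
  have hgx : g x = (1 + η) • x := by
    rw [← smul_inv_smul₀ (by positivity : 1 + η ≠ 0) (g x)]
    exact congrArg _ hfix
  have h1 : ‖x - g x‖ ≤ η := by
    have : x - g x = -(η • x) := by rw [hgx]; module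
    rw [this, norm_neg, norm_smul, Real.norm_of_nonneg hη0.le]
    exact mul_le_of_le_one_right hη0.le (by simpa using hx)
  have h2 := hgF x
  rw [dist_eq_norm] at h2
  have h3 : ‖x₀ - F x₀‖ ≤ ‖x - F x‖ := hmin hx
  have h4 := norm_sub_le_norm_sub_add_norm_sub x (g x) (F x)
  linarith

theorem exists_continuous_retraction_stdSimplex (ι : Type*) [Fintype ι] [Nonempty ι] :
    ∃ ρ : (ι → ℝ) → stdSimplex ℝ ι, Continuous ρ ∧ ∀ w : stdSimplex ℝ ι, ρ w.1 = w := by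
  let s : (ι → ℝ) → ℝ := fun v => ∑ i, max (v i) 0
  -- take positive parts, raise the sum to at least `1` by adding a constant vector, and normalize
  let ρ : (ι → ℝ) → ι → ℝ := fun v i =>
    (max (v i) 0 + max (1 - s v) 0 / Fintype.card ι) / max (s v) 1
  have hs : Continuous s := by fun_prop
  have hpos : ∀ v, 0 < max (s v) 1 := fun v => lt_max_of_lt_right one_pos
  have hcard : (Fintype.card ι : ℝ) ≠ 0 := Nat.cast_ne_zero.2 Fintype.card_ne_zero
  have hmem : ∀ v, ρ v ∈ stdSimplex ℝ ι := by
    refine fun v => ⟨fun i => ?_, ?_⟩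
    · exact div_nonneg (add_nonneg (le_max_right _ _)
        (div_nonneg (le_max_right _ _) (Nat.cast_nonneg _))) (hpos v).le
    · rw [← Finset.sum_div, Finset.sum_add_distrib, Finset.sum_const, Finset.card_univ,
        nsmul_eq_mul, mul_div_cancel₀ _ hcard, div_eq_one_iff_eq (hpos v).ne']
      change s v + max (1 - s v) 0 = max (s v) 1
      rw [← max_add_add_left, add_zero, add_sub_cancel, max_comm]
  have hcont : Continuous ρ := continuous_pi fun i =>
    Continuous.div (by fun_prop) (by fun_prop) fun v => (hpos v).ne'
  refine ⟨fun v => ⟨ρ v, hmem v⟩, hcont.subtype_mk _, fun w => Subtype.ext (funext fun i => ?_)⟩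
  have h0 : ∀ i, max (w.1 i) 0 = w.1 i := fun i => max_eq_left (w.2.1 i)
  have h1 : s w.1 = 1 := by simp only [s, h0]; exact w.2.2
  change (max (w.1 i) 0 + max (1 - s w.1) 0 / Fintype.card ι) / max (s w.1) 1 = w.1 i
  rw [h1, h0]
  simp

/-- **Brouwer's fixed point theorem** on the standard simplex. -/
theorem exists_isFixedPt_stdSimplex {ι : Type*} [Fintype ι] [Nonempty ι]
    {f : stdSimplex ℝ ι → stdSimplex ℝ ι} (hf : Continuous f) : ∃ w, f w = w := by
  obtain ⟨ρ, hρ, hρid⟩ := exists_continuous_retraction_stdSimplex ι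
  let F : EuclideanSpace ℝ ι → EuclideanSpace ℝ ι := fun v =>
    WithLp.toLp 2 (f (ρ (WithLp.ofLp v))).1
  have hF : Continuous F := (PiLp.continuous_toLp 2 _).comp
    (continuous_subtype_val.comp (hf.comp (hρ.comp (PiLp.continuous_ofLp 2 _))))
  obtain ⟨v, hv⟩ := exists_isFixedPt_of_norm_le_one hF fun v => by
    obtain ⟨h0, h1⟩ := (f (ρ (WithLp.ofLp v))).2
    rw [← sq_le_one_iff₀ (norm_nonneg _), EuclideanSpace.real_norm_sq_eq, ← h1]
    refine Finset.sum_le_sum fun i hi => ?_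
    have hi1 : (f (ρ (WithLp.ofLp v))).1 i ≤ 1 := h1 ▸ Finset.single_le_sum (fun j _ => h0 j) hi
    exact pow_le_of_le_one (h0 i) hi1 two_ne_zero
  refine ⟨f (ρ (WithLp.ofLp v)), ?_⟩
  have h1 : (f (ρ (WithLp.ofLp v))).1 = WithLp.ofLp v := congrArg WithLp.ofLp hv
  have h2 := hρid (f (ρ (WithLp.ofLp v)))
  rw [h1] at h2
  rw [← h2]
  exact h2.symm

end Brouwer

/-! ### Schauder's fixed point theorem -/

section Schauder

open Metric Set Filter Topology

/-- Continuous partition of unity subordinate to the balls of radius `ε` about the points of a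
finite `ε`-net. -/
theorem exists_continuous_weights {X ι : Type*} [PseudoMetricSpace X] [Fintype ι] {K : Set X}
    {ε : ℝ} {p : ι → X} (hp : ∀ y ∈ K, ∃ i, dist y (p i) < ε) :
    ∃ l : K → stdSimplex ℝ ι, Continuous l ∧ ∀ y i, (l y).1 i ≠ 0 → dist y.1 (p i) < ε := by
  let m : K → ι → ℝ := fun y i => max (ε - dist y.1 (p i)) 0
  have hm0 : ∀ y i, 0 ≤ m y i := fun y i => le_max_right _ _
  have hpos : ∀ y, 0 < ∑ i, m y i := fun y => by
    obtain ⟨i, hi⟩ := hp y y.2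
    exact Finset.sum_pos' (fun j _ => hm0 y j)
      ⟨i, Finset.mem_univ i, lt_max_of_lt_left (sub_pos.2 hi)⟩
  refine ⟨fun y => ⟨fun i => m y i / ∑ j, m y j, fun i => div_nonneg (hm0 y i) (hpos y).le, ?_⟩,
    ?_, fun y i hi => ?_⟩
  · rw [← Finset.sum_div, div_self (hpos y).ne']
  · exact Continuous.subtype_mk (continuous_pi fun i =>
      Continuous.div (by fun_prop) (by fun_prop) fun y => (hpos y).ne') _
  · by_contra! hle
    exact hi (by simp [m, hle])

/-- A continuous self-map of a convex set with image in a compact subset moves some point by at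
most `ε`: Brouwer's theorem applies to its composition with the Schauder projection onto the hull
of a finite `ε`-net. -/
theorem exists_dist_le_of_mapsTo_compact {X : Type*} [NormedAddCommGroup X] [NormedSpace ℝ X]
    {S K : Set X} (hS : Convex ℝ S) (hne : S.Nonempty) (hK : IsCompact K) (hKS : K ⊆ S)
    {T : S → X} (hT : Continuous T) (hTK : ∀ x, T x ∈ K) {ε : ℝ} (hε : 0 < ε) :
    ∃ x : S, dist (T x) x ≤ ε := by
  obtain ⟨t, htK, htfin, hcov⟩ := hK.finite_cover_balls hε
  have := htfin.fintype
  have hp : ∀ y ∈ K, ∃ i : t, dist y (i : X) < ε := fun y hy => by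
    obtain ⟨i, hi, hyi⟩ := mem_iUnion₂.1 (hcov hy)
    exact ⟨⟨i, hi⟩, hyi⟩
  obtain ⟨x₀, hx₀⟩ := hne
  have : Nonempty t := (hp _ (hTK ⟨x₀, hx₀⟩)).nonempty
  obtain ⟨l, hl, hlε⟩ := exists_continuous_weights hp
  let q : stdSimplex ℝ t → S := fun w =>
    ⟨∑ i, w.1 i • (i : X), hS.sum_mem (fun i _ => w.2.1 i) w.2.2 fun i _ => hKS (htK i.2)⟩
  have hq : Continuous q := by
    refine Continuous.subtype_mk (continuous_finsetSum _ fun i _ => ?_) _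
    exact ((continuous_apply i).comp continuous_subtype_val).smul continuous_const
  obtain ⟨w, hw⟩ := exists_isFixedPt_stdSimplex
    (hl.comp ((hT.subtype_mk hTK).comp hq))
  refine ⟨q w, ?_⟩
  have h1 : T (q w) - q w = ∑ i, w.1 i • (T (q w) - (i : X)) := by
    simp_rw [smul_sub, Finset.sum_sub_distrib, ← Finset.sum_smul]
    rw [show ∑ i, w.1 i = 1 from w.2.2, one_smul]
  rw [dist_eq_norm, h1]
  calc ‖∑ i, w.1 i • (T (q w) - (i : X))‖ ≤ ∑ i, w.1 i * ε := by
        refine norm_sum_le_of_le _ fun i _ => ?_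
        rw [norm_smul, Real.norm_of_nonneg (w.2.1 i)]
        rcases eq_or_ne (w.1 i) 0 with h | h
        · simp [h]
        · refine mul_le_mul_of_nonneg_left ?_ (w.2.1 i)
          rw [← hw] at h
          rw [← dist_eq_norm]
          exact (hlε _ _ h).le
    _ = ε := by rw [← Finset.sum_mul, show ∑ i, w.1 i = 1 from w.2.2, one_mul]

/-- **Schauder's fixed point theorem**: a continuous self-map of a nonempty convex set with image in
a compact subset has a fixed point. -/
theorem exists_isFixedPt_of_mapsTo_compact {X : Type*} [NormedAddCommGroup X] [NormedSpace ℝ X]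
    {S K : Set X} (hS : Convex ℝ S) (hne : S.Nonempty) (hK : IsCompact K) (hKS : K ⊆ S)
    {T : S → X} (hT : Continuous T) (hTK : ∀ x, T x ∈ K) : ∃ x : S, T x = x := by
  choose x hx using fun n : ℕ =>
    exists_dist_le_of_mapsTo_compact hS hne hK hKS hT hTK (Nat.one_div_pos_of_nat (α := ℝ) (n := n))
  obtain ⟨y, hy, σ, hσ, hlim⟩ := hK.tendsto_subseq fun n => hTK (x n)
  have hdist : Tendsto (fun n => dist (T (x (σ n))) (x (σ n))) atTop (𝓝 0) :=
    (squeeze_zero (fun _ => dist_nonneg) hx tendsto_one_div_add_atTop_nhds_zero_nat).comp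
      hσ.tendsto_atTop
  have hxlim : Tendsto (fun n => (x (σ n) : X)) atTop (𝓝 y) := hlim.congr_dist hdist
  have hxlim' : Tendsto (fun n => x (σ n)) atTop (𝓝 ⟨y, hKS hy⟩) := tendsto_subtype_rng.2 hxlim
  exact ⟨⟨y, hKS hy⟩, tendsto_nhds_unique ((hT.tendsto _).comp hxlim') hlim⟩

end Schauder

/-! ### The sum of a weak contraction and a compact map -/

theorem theorem3p2 {X : Type*} [NormedAddCommGroup X] [NormedSpace ℝ X] [CompleteSpace X]
    (P : ProperCone ℝ X) (hP : IsOrderCone P) (hup : UpperComparable P)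
    (S : Set X) (hS_nonempty : S.Nonempty) (hS_closed : IsClosed S)
    (hS_convex : Convex ℝ S) (hS_bounded : Bornology.IsBounded S)
    (A : X → X) (B : S → X)
    (hA_contr : ∃ ψ θ φ : ℝ≥0 → ℝ≥0, IsWeakContraction P ψ θ φ A)
    (hA_start : ∃ x₀ : X, ConeLE P x₀ (A x₀))
    (hA_cont : Continuous A)
    (hA_mono : ∀ x y : X, ConeLE P x y → ConeLE P (A x) (A y))
    (hA_inv : HasContinuousInverse (fun x : X => x - A x))
    (hB_cont : Continuous B)
    (hB_compact : ∃ K : Set X, IsCompact K ∧ K ⊆ (P : Set X) ∧ Set.range B ⊆ K)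
    (hAB : ∀ (y : S) (x : X), x = A x + B y → x ∈ S) :
    ∃ x : S, A x + B x = x := by
  obtain ⟨ψ, θ, φ, hA⟩ := hA_contr
  obtain ⟨K, hK, hKP, hBK⟩ := hB_compact
  obtain ⟨hinj, hinv⟩ := hA_inv
  let R : Set X := Set.range fun x : X => x - A x
  let N : R → X := fun k => (Equiv.ofInjective _ hinj).symm k
  have hNspec : ∀ k : R, N k - A (N k) = k := fun k => Equiv.apply_ofInjective_symm hinj k
  -- the range of `I - A` contains the cone, hence all of `K`, so its inverse is defined on `K`
  have hKR : K ⊆ R := fun k hk => by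
    obtain ⟨x, hx⟩ := hA.exists_eq_add hA_cont hA_mono hA_start (hKP hk)
    exact ⟨x, sub_eq_iff_eq_add'.2 hx⟩
  have hBK' : ∀ y : S, B y ∈ K := fun y => hBK (Set.mem_range_self y)
  let T : S → X := fun y => N ⟨B y, hKR (hBK' y)⟩
  have hTspec : ∀ y, T y = A (T y) + B y := fun y => sub_eq_iff_eq_add'.1 (hNspec _)
  have hT : Continuous T := hinv.comp (hB_cont.subtype_mk _)
  have hC : IsCompact (N '' (Subtype.val ⁻¹' K)) :=
    (Topology.IsInducing.subtypeVal.isCompact_preimage' hK (by simpa using hKR)).image hinv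
  obtain ⟨x, hx⟩ := exists_isFixedPt_of_mapsTo_compact hS_convex hS_nonempty
    (hC.inter_left hS_closed) Set.inter_subset_left hT
    fun y => ⟨hAB y _ (hTspec y), _, hBK' y, rfl⟩
  refine ⟨x, ?_⟩
  have h := hTspec x
  rw [hx] at h
  exact h.symm
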